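/- For $\lambda>0$, $\psi:\mathbb R^3\to\mathbb C$ and $f:\mathbb R\to\mathbb C$ put $$T_\lambda^\psi f(x,y)=\int_{\mathbb R}e^{i\lambda(x^2t+yt^2)}\,\psi(x,y,t)\,f(t)\,dt,\qquad (x,y)\in\mathbb R^2.$$ Let $\mathcal U$ be the class of measurable functions $\psi(x,y,t)$ on $\mathbb R^3$ with $\operatorname{supp}\psi\subset[-1,1]^3$ that are of class $C^3$ in $t$ for each fixed $(x,y)$ and satisfy $|\partial_t^j\psi|\le 1$ everywhere for $j=1,2,3$. Let $$Q_4(\lambda)=\sup_{\psi\in\mathcal U}\ \sup_{\|f\|_{L^4(\mathbb R)}\le 1}\|T_\lambda^\psi f\|_{L^4(\mathbb R^2)}.$$ Then there is an absolute constant $C$ such that for every real $K>10^4$ and every $\lambda>0$, $$Q_4(\lambda)\le C\left(K\lambda^{-3/8}+K^{-1/2}\,Q_4(\lambda/K)\right).$$ -/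

import Mathlib

open MeasureTheory
open scoped ENNReal NNReal ContDiff

/-- The operator `T_lam^psi f (x, y) = ∫ exp (i lam (x^2 t + y t^2)) psi (x, y, t) f t dt`. -/
noncomputable def oscOp (lam : ℝ) (psi : ℝ × ℝ × ℝ → ℂ) (f : ℝ → ℂ) (z : ℝ × ℝ) : ℂ :=
  ∫ t : ℝ, Complex.exp (Complex.I * ((lam * (z.1 ^ 2 * t + z.2 * t ^ 2) : ℝ) : ℂ)) *
    psi (z.1, z.2, t) * f t

/-- The cutoff class: measurable functions `psi (x, y, t)` supported in `[-1, 1]^3`, of class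
`C^3` in `t`, with `|∂_t^j psi| ≤ 1` for `j = 1, 2, 3`. -/
def cutoffClass : Set (ℝ × ℝ × ℝ → ℂ) :=
  {psi | Measurable psi ∧
    tsupport psi ⊆ Set.Icc (-1 : ℝ) 1 ×ˢ (Set.Icc (-1 : ℝ) 1 ×ˢ Set.Icc (-1 : ℝ) 1) ∧
    (∀ x y : ℝ, ContDiff ℝ 3 (fun t : ℝ => psi (x, y, t))) ∧
    ∀ j ∈ Finset.Icc 1 3, ∀ x y t : ℝ, ‖iteratedDeriv j (fun s : ℝ => psi (x, y, s)) t‖ ≤ 1}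

/-- `Q_p(lam)`: the supremum over the cutoff class and over the unit ball of `L^p(ℝ)` of the
`L^p(ℝ^2)` norm of `T_lam^psi f`, as an element of `[0, ∞]`. -/
noncomputable def oscQ (p : ℝ≥0∞) (lam : ℝ) : ℝ≥0∞ :=
  ⨆ psi ∈ cutoffClass, ⨆ f ∈ {f : ℝ → ℂ | MemLp f p volume ∧ eLpNorm f p volume ≤ 1},
    eLpNorm (oscOp lam psi f) p (volume : Measure (ℝ × ℝ))

/-!
The recursive inequality follows from the bound `Q_4(lam) ≤ 106 lam ^ (-3/8)`
(`oscQ_four_le`), which holds for every `lam > 0`: since `K ≥ 1`, the first summand on the right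
already dominates it, and the recursive term is not needed. For large `lam` the exponent `-3/8` is
attained by a cutoff and a density that are constant near the origin, tested on
`|x| ≲ lam ^ (-1/2)`, `|y| ≲ lam⁻¹`.

**Removing the cutoff.** As `psi (x, y, ·)` vanishes at `2`, it is minus the integral of its
`t`-derivative over `[t, 2]`. Hence `T f` is a superposition, with coefficients bounded by `1`, of
the functions `E (f 1_{t < τ})` for `-1 < τ ≤ 2`, where
`E g (x, y) = ∫_{-1}^1 exp (i lam (x² t + y t²)) g t dt` (`enorm_oscOp_le`).

**The `L⁴` bound for `E`.** On `[-1, 1]²` the weight `exp (-x² - y²)` is bounded below, and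
`(E g)²` is an oscillatory integral over pairs `P = (t, s)` with density `g t * g s`. Expanding the
weighted `L²` norm of `(E g)²` (`lintegral_sq_norm_integral_le`) gives a quadratic form whose kernel
is a Gaussian integral: for `P = (t, s)`, `P' = (t', s')` it is at most
`4 lam ^ (-1/2) |A| ^ (-1/2) exp (-lam² B² / 4)` with `A = t + s - t' - s'` and
`B = t² + s² - t'² - s'²` (`enorm_integral_gaussian_phase_le`). The slow decay `|A| ^ (-1/2)`
reflects the degeneracy of the phase at `x = 0`.

**Schur's test.** With the weight `|t - s| ^ (3/4)`, the coordinates `p = t + s`, `q = t - s` and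
the substitution `v = q²` bound the Schur integral by a multiple of `lam⁻¹`
(`lintegral_schur_weight_le`). There remains `∫∫ |g t|² |g s|² |t - s| ^ (-3/4)`, at most a multiple
of `‖g‖₄⁴` by Schur's test again, the kernel `|t - s| ^ (-3/4)` being integrable on `[-1, 1]`. The
weight `|t - s|` itself would be absorbed exactly by the substitution, but `|t - s|⁻¹` just fails to
be integrable; any exponent slightly below `1` leaves a singularity in `v` that is still harmless.

Singular kernels are written as extended nonnegative reals `‖u‖ₑ ^ (-r)`, which equal `∞` at
`u = 0`, so that the pointwise bounds hold without exceptions.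
-/

/-! ### Schur's test and the `T T*` argument -/

theorem ENNReal.mul_le_sq_mul_add_sq_mul_inv (a b : ℝ≥0∞) {r : ℝ≥0∞} (h0 : r ≠ 0) (ht : r ≠ ⊤) :
    a * b ≤ a ^ 2 * r + b ^ 2 * r⁻¹ := by
  rcases le_total b (a * r) with h | h
  · calc a * b ≤ a * (a * r) := by gcongr
      _ = a ^ 2 * r := by ring
      _ ≤ _ := le_self_add
  · have h' : a ≤ b * r⁻¹ := by
      rw [← div_eq_mul_inv]; exact (ENNReal.le_div_iff_mul_le (Or.inl h0) (Or.inl ht)).2 h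
    calc a * b ≤ (b * r⁻¹) * b := by gcongr
      _ = b ^ 2 * r⁻¹ := by ring
      _ ≤ _ := le_add_self

/-- Schur's test for a symmetric kernel `k` and a weight `W`, as a bound of the quadratic form of `k`
by a weighted `L²` norm. -/
theorem lintegral_lintegral_mul_le_of_schur {X : Type*} [MeasurableSpace X] {ν : Measure X}
    [SFinite ν] {k : X → X → ℝ≥0∞} (hk : Measurable (Function.uncurry k))
    (hsymm : ∀ P P', k P P' = k P' P) {W G : X → ℝ≥0∞} (hW : Measurable W) (hG : AEMeasurable G ν)
    (hW0 : ∀ᵐ P ∂ν, W P ≠ 0) (hWt : ∀ᵐ P ∂ν, W P ≠ ⊤) {M : ℝ≥0∞}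
    (hM : ∀ᵐ P ∂ν, ∫⁻ P', k P P' * W P' ∂ν ≤ M) :
    ∫⁻ P, ∫⁻ P', G P * G P' * k P P' ∂ν ∂ν ≤ 2 * M * ∫⁻ P, G P ^ 2 * (W P)⁻¹ ∂ν := by
  -- the two halves of `G P * G P' ≤ G P ^ 2 * r + G P' ^ 2 * r⁻¹`, where `r = W P' / W P`, have
  -- equal integrals by symmetry
  have hone : ∫⁻ P, ∫⁻ P', G P ^ 2 * (W P' * (W P)⁻¹) * k P P' ∂ν ∂ν
      ≤ M * ∫⁻ P, G P ^ 2 * (W P)⁻¹ ∂ν := by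
    rw [← lintegral_const_mul'' (f := fun P => G P ^ 2 * (W P)⁻¹) _
      ((hG.pow_const 2).mul hW.inv.aemeasurable)]
    refine lintegral_mono_ae ?_
    filter_upwards [hM] with P hP
    have hkP : Measurable fun P' => k P P' * W P' := (hk.comp measurable_prodMk_left).mul hW
    calc ∫⁻ P', G P ^ 2 * (W P' * (W P)⁻¹) * k P P' ∂ν
        = ∫⁻ P', G P ^ 2 * (W P)⁻¹ * (k P P' * W P') ∂ν := by
          refine lintegral_congr fun P' => ?_; ring
      _ = G P ^ 2 * (W P)⁻¹ * ∫⁻ P', k P P' * W P' ∂ν := lintegral_const_mul _ hkP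
      _ ≤ G P ^ 2 * (W P)⁻¹ * M := by gcongr
      _ = _ := mul_comm _ _
  have hmeas : AEMeasurable (fun z : X × X => G z.1 ^ 2 * (W z.2 * (W z.1)⁻¹) * k z.1 z.2)
      (ν.prod ν) :=
    ((hG.comp_fst.pow_const 2).mul
      ((hW.comp measurable_snd).mul (hW.comp measurable_fst).inv).aemeasurable).mul hk.aemeasurable
  have htwo : ∫⁻ P, ∫⁻ P', G P' ^ 2 * (W P * (W P')⁻¹) * k P P' ∂ν ∂ν
      = ∫⁻ P, ∫⁻ P', G P ^ 2 * (W P' * (W P)⁻¹) * k P P' ∂ν ∂ν := by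
    rw [lintegral_lintegral_swap (f := fun P P' => G P ^ 2 * (W P' * (W P)⁻¹) * k P P') hmeas]
    refine lintegral_congr fun P => lintegral_congr fun P' => ?_
    rw [hsymm P' P]
  calc ∫⁻ P, ∫⁻ P', G P * G P' * k P P' ∂ν ∂ν
      ≤ ∫⁻ P, ∫⁻ P', (G P ^ 2 * (W P' * (W P)⁻¹) * k P P'
          + G P' ^ 2 * (W P * (W P')⁻¹) * k P P') ∂ν ∂ν := by
        refine lintegral_mono_ae ?_
        filter_upwards [hW0, hWt] with P h0 ht
        refine lintegral_mono_ae ?_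
        filter_upwards [hW0, hWt] with P' h0' ht'
        rw [← add_mul]
        gcongr
        have := ENNReal.mul_le_sq_mul_add_sq_mul_inv (G P) (G P') (r := W P' * (W P)⁻¹)
          (mul_ne_zero h0' (ENNReal.inv_ne_zero.2 ht))
          (ENNReal.mul_ne_top ht' (ENNReal.inv_ne_top.2 h0))
        rwa [ENNReal.mul_inv (Or.inl h0') (Or.inl ht'), inv_inv, mul_comm (W P')⁻¹] at this
    _ = ∫⁻ P, ∫⁻ P', G P ^ 2 * (W P' * (W P)⁻¹) * k P P' ∂ν ∂ν
          + ∫⁻ P, ∫⁻ P', G P' ^ 2 * (W P * (W P')⁻¹) * k P P' ∂ν ∂ν := by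
        rw [← lintegral_add_left' hmeas.lintegral_prod_right']
        refine lintegral_congr_ae ?_
        filter_upwards with P
        refine lintegral_add_left' ?_ _
        exact (((hW.mul_const _).const_mul _).mul (hk.comp measurable_prodMk_left)).aemeasurable
    _ ≤ _ := by rw [htwo, ← two_mul, mul_assoc]; gcongr

/-- The `T T*` argument: the weighted `L²` norm of an oscillatory integral is bounded by the quadratic
form whose kernel is the modulus of the weighted inner product of the oscillating factors. -/
theorem lintegral_sq_norm_integral_le {Z X : Type*} [MeasurableSpace Z] [MeasurableSpace X]
    {μ : Measure Z} {ν : Measure X} [SFinite μ] [SFinite ν] {w : Z → ℝ} (hw : Integrable w μ)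
    (hw0 : ∀ z, 0 ≤ w z) {κ : Z → X → ℂ} (hκ : Measurable (Function.uncurry κ))
    (hκ1 : ∀ z P, ‖κ z P‖ ≤ 1) {G : X → ℂ} (hG : Integrable G ν) :
    ∫⁻ z, ENNReal.ofReal (w z) * ‖∫ P, κ z P * G P ∂ν‖ₑ ^ 2 ∂μ ≤
      ∫⁻ P, ∫⁻ P', ‖G P‖ₑ * ‖G P'‖ₑ *
        ‖∫ z, (w z : ℂ) * (κ z P * (starRingEnd ℂ) (κ z P')) ∂μ‖ₑ ∂ν ∂ν := by
  set D : Z × (X × X) → ℂ := fun q => ((w q.1 : ℂ)) * ((κ q.1 q.2.1 * G q.2.1) *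
    (starRingEnd ℂ) (κ q.1 q.2.2 * G q.2.2)) with hD
  have hDint : Integrable D (μ.prod (ν.prod ν)) := by
    have h1 : Integrable (fun q : Z × (X × X) => (w q.1 : ℂ) *
        (G q.2.1 * (starRingEnd ℂ) (G q.2.2))) (μ.prod (ν.prod ν)) := by
      refine Integrable.mul_prod (f := fun z => (w z : ℂ))
        (g := fun p : X × X => G p.1 * (starRingEnd ℂ) (G p.2)) hw.ofReal ?_
      refine Integrable.mul_prod (f := G) (g := fun P => (starRingEnd ℂ) (G P)) hG ?_
      exact Complex.conjCLE.toContinuousLinearMap.integrable_comp hG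
    have hm : AEStronglyMeasurable (fun q : Z × (X × X) => κ q.1 q.2.1 *
        (starRingEnd ℂ) (κ q.1 q.2.2)) (μ.prod (ν.prod ν)) := by
      have a1 : Measurable fun q : Z × (X × X) => κ q.1 q.2.1 :=
        hκ.comp (measurable_fst.prodMk measurable_snd.fst)
      have a2 : Measurable fun q : Z × (X × X) => κ q.1 q.2.2 :=
        hκ.comp (measurable_fst.prodMk measurable_snd.snd)
      exact (a1.mul (Complex.continuous_conj.measurable.comp a2)).aestronglyMeasurable
    refine (h1.bdd_mul (c := 1) hm ?_).congr ?_
    · filter_upwards with q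
      rw [norm_mul, RCLike.norm_conj]
      exact mul_le_one₀ (hκ1 _ _) (norm_nonneg _) (hκ1 _ _)
    · filter_upwards with q
      simp only [hD, map_mul]; ring
  have hsq : ∀ z, ∫ p : X × X, D (z, p) ∂(ν.prod ν)
      = ((w z * ‖∫ P, κ z P * G P ∂ν‖ ^ 2 : ℝ) : ℂ) := by
    intro z
    simp only [hD]
    rw [integral_const_mul, integral_prod_mul (fun P => κ z P * G P)
      (fun P => (starRingEnd ℂ) (κ z P * G P)), integral_conj, Complex.mul_conj']
    push_cast; ring
  have hint : Integrable (fun z => w z * ‖∫ P, κ z P * G P ∂ν‖ ^ 2) μ := by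
    have := hDint.integral_prod_left.re
    refine this.congr ?_
    filter_upwards with z
    rw [hsq z]; exact Complex.ofReal_re _
  have hnn : ∀ z, 0 ≤ w z * ‖∫ P, κ z P * G P ∂ν‖ ^ 2 := fun z =>
    mul_nonneg (hw0 z) (sq_nonneg _)
  calc ∫⁻ z, ENNReal.ofReal (w z) * ‖∫ P, κ z P * G P ∂ν‖ₑ ^ 2 ∂μ
      = ∫⁻ z, ENNReal.ofReal (w z * ‖∫ P, κ z P * G P ∂ν‖ ^ 2) ∂μ := by
        refine lintegral_congr fun z => ?_
        rw [ENNReal.ofReal_mul (hw0 z), ENNReal.ofReal_pow (norm_nonneg _), ofReal_norm]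
    _ = ENNReal.ofReal (∫ z, w z * ‖∫ P, κ z P * G P ∂ν‖ ^ 2 ∂μ) :=
        (ofReal_integral_eq_lintegral_ofReal hint (Filter.Eventually.of_forall hnn)).symm
    _ = ‖∫ z, ∫ p : X × X, D (z, p) ∂(ν.prod ν) ∂μ‖ₑ := by
        simp_rw [hsq]
        rw [integral_complex_ofReal, ← ofReal_norm, Complex.norm_real, Real.norm_of_nonneg]
        exact integral_nonneg hnn
    _ = ‖∫ p : X × X, ∫ z, D (z, p) ∂μ ∂(ν.prod ν)‖ₑ := by
        rw [integral_integral_swap hDint]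
    _ ≤ ∫⁻ p : X × X, ‖∫ z, D (z, p) ∂μ‖ₑ ∂(ν.prod ν) := enorm_integral_le_lintegral_enorm _
    _ = ∫⁻ P, ∫⁻ P', ‖∫ z, D (z, (P, P')) ∂μ‖ₑ ∂ν ∂ν :=
        lintegral_prod _ hDint.integral_prod_right.aestronglyMeasurable.enorm
    _ = _ := by
        refine lintegral_congr fun P => lintegral_congr fun P' => ?_
        have : ∀ z, D (z, (P, P')) = (G P * (starRingEnd ℂ) (G P')) *
            ((w z : ℂ) * (κ z P * (starRingEnd ℂ) (κ z P'))) := by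
          intro z; simp only [hD, map_mul]; ring
        simp_rw [this]
        rw [integral_const_mul, enorm_mul, enorm_mul, RCLike.enorm_conj]

/-! ### Integrals of power singularities against Gaussians -/

theorem setLIntegral_enorm_rpow_neg_Ioc {r : ℝ} (hr : r < 1) {d : ℝ} (hd : 0 ≤ d) :
    ∫⁻ u in Set.Ioc 0 d, ‖u‖ₑ ^ (-r) = ENNReal.ofReal (d ^ (1 - r) / (1 - r)) := by
  have h1 : ∫⁻ u in Set.Ioc 0 d, ‖u‖ₑ ^ (-r) = ∫⁻ u in Set.Ioc 0 d, ENNReal.ofReal (u ^ (-r)) := by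
    refine setLIntegral_congr_fun measurableSet_Ioc fun u hu => ?_
    rw [← ENNReal.ofReal_rpow_of_pos hu.1, Real.enorm_of_nonneg hu.1.le]
  have hi : IntervalIntegrable (fun u : ℝ => u ^ (-r)) volume 0 d :=
    intervalIntegral.intervalIntegrable_rpow' (by linarith)
  rw [h1, ← ofReal_integral_eq_lintegral_ofReal
    ((intervalIntegrable_iff_integrableOn_Ioc_of_le hd).1 hi), ← intervalIntegral.integral_of_le hd,
    integral_rpow (Or.inl (by linarith)), show -r + 1 = 1 - r by ring,
    Real.zero_rpow (by linarith), sub_zero]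
  exact (ae_restrict_iff' measurableSet_Ioc).2
    (Filter.Eventually.of_forall fun u hu => Real.rpow_nonneg hu.1.le _)

theorem setLIntegral_enorm_rpow_neg_Icc {r : ℝ} (hr : r < 1) :
    ∫⁻ u in Set.Icc (-1 : ℝ) 1, ‖u‖ₑ ^ (-r) ≤ ENNReal.ofReal (2 / (1 - r)) := by
  have h0 := setLIntegral_enorm_rpow_neg_Ioc hr zero_le_one
  have hneg : ∫⁻ u in Set.Ico (-1 : ℝ) 0, ‖u‖ₑ ^ (-r) = ∫⁻ u in Set.Ioc (0 : ℝ) 1, ‖u‖ₑ ^ (-r) := by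
    rw [← lintegral_indicator measurableSet_Ico, ← lintegral_indicator measurableSet_Ioc,
      ← lintegral_neg_eq_self]
    refine lintegral_congr fun u => ?_
    simp only [Set.indicator, Set.mem_Ico, Set.mem_Ioc, enorm_neg]
    refine if_congr ?_ rfl rfl
    constructor <;> rintro ⟨h1, h2⟩ <;> constructor <;> linarith
  have hsub : Set.Icc (-1 : ℝ) 1 ⊆ (Set.Ico (-1 : ℝ) 0 ∪ Set.Ioc (0 : ℝ) 1) ∪ {0} := by
    intro u hu
    rcases lt_trichotomy u 0 with h | h | h
    · exact Or.inl (Or.inl ⟨hu.1, h⟩)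
    · exact Or.inr h
    · exact Or.inl (Or.inr ⟨h, hu.2⟩)
  calc ∫⁻ u in Set.Icc (-1 : ℝ) 1, ‖u‖ₑ ^ (-r)
      ≤ ∫⁻ u in (Set.Ico (-1 : ℝ) 0 ∪ Set.Ioc (0 : ℝ) 1) ∪ {0}, ‖u‖ₑ ^ (-r) :=
        lintegral_mono_set hsub
    _ ≤ (∫⁻ u in Set.Ico (-1 : ℝ) 0, ‖u‖ₑ ^ (-r)) + (∫⁻ u in Set.Ioc (0 : ℝ) 1, ‖u‖ₑ ^ (-r))
          + ∫⁻ u in ({0} : Set ℝ), ‖u‖ₑ ^ (-r) :=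
        (lintegral_union_le _ _ _).trans (by gcongr; exact lintegral_union_le _ _ _)
    _ = ENNReal.ofReal (2 / (1 - r)) := by
        rw [hneg, h0, setLIntegral_measure_zero _ _ (by simp), add_zero,
          ← ENNReal.ofReal_add (by rw [Real.one_rpow]; exact one_div_nonneg.2 (by linarith))
            (by rw [Real.one_rpow]; exact one_div_nonneg.2 (by linarith)), Real.one_rpow]
        congr 1; ring

/-- A bound for translates of `|u| ^ (-r)` that is uniform in the centre `β`. -/
theorem setLIntegral_enorm_sub_rpow_neg_le {r : ℝ} (hr0 : 0 < r) (hr : r < 1) (β : ℝ) (s : Set ℝ) :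
    ∫⁻ u in s, ‖β - u‖ₑ ^ (-r) ≤ volume s + ENNReal.ofReal (2 / (1 - r)) := by
  have hpt : ∀ u : ℝ, ‖β - u‖ₑ ^ (-r) ≤
      1 + (Set.Icc (-1 : ℝ) 1).indicator (fun v => ‖v‖ₑ ^ (-r)) (β - u) := by
    intro u
    by_cases h : β - u ∈ Set.Icc (-1 : ℝ) 1
    · rw [Set.indicator_of_mem h]; exact le_add_self
    · refine le_trans ?_ le_self_add
      have h1 : 1 ≤ ‖β - u‖ₑ := by
        rw [← ofReal_norm, ENNReal.one_le_ofReal, Real.norm_eq_abs]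
        by_contra! hc
        exact h (abs_le.1 hc.le)
      rw [ENNReal.rpow_neg, ENNReal.inv_le_one]
      exact ENNReal.one_le_rpow h1 hr0
  calc ∫⁻ u in s, ‖β - u‖ₑ ^ (-r)
      ≤ ∫⁻ u in s, (1 + (Set.Icc (-1 : ℝ) 1).indicator (fun v => ‖v‖ₑ ^ (-r)) (β - u)) :=
        lintegral_mono hpt
    _ = volume s + ∫⁻ u in s, (Set.Icc (-1 : ℝ) 1).indicator (fun v => ‖v‖ₑ ^ (-r)) (β - u) := by
        rw [lintegral_add_left measurable_const, setLIntegral_one]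
    _ ≤ volume s + ∫⁻ u, (Set.Icc (-1 : ℝ) 1).indicator (fun v => ‖v‖ₑ ^ (-r)) (β - u) := by
        gcongr; exact Measure.restrict_le_self
    _ ≤ _ := by
        rw [lintegral_sub_left_eq_self (fun v => (Set.Icc (-1 : ℝ) 1).indicator
          (fun v => ‖v‖ₑ ^ (-r)) v) β, lintegral_indicator measurableSet_Icc]
        gcongr; exact setLIntegral_enorm_rpow_neg_Icc hr

theorem lintegral_gaussian_sub {μ : ℝ} (hμ : 0 < μ) (c : ℝ) :
    ∫⁻ v : ℝ, ENNReal.ofReal (Real.exp (-μ * (c - v) ^ 2)) = ENNReal.ofReal √(Real.pi / μ) := by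
  rw [lintegral_sub_left_eq_self (fun v => ENNReal.ofReal (Real.exp (-μ * v ^ 2))) c,
    ← ofReal_integral_eq_lintegral_ofReal (integrable_exp_neg_mul_sq hμ)
      (Filter.Eventually.of_forall fun _ => (Real.exp_pos _).le), integral_gaussian]

/-- A Gaussian of width `lam⁻¹` centred at `c` integrates `v ^ (-1/8)` as if that function were
constant, equal to its value at `|c|`. The proof separates `v > |c| / 2` from `v ≤ |c| / 2`; in the
latter range the Gaussian is at most `exp (-lam² c² / 64)`. -/
theorem lintegral_rpow_neg_mul_gaussian_le {lam : ℝ} (hl : 0 < lam) (c : ℝ) :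
    ∫⁻ v in Set.Ioi (0 : ℝ), ‖v‖ₑ ^ (-(1 / 8) : ℝ) *
        ENNReal.ofReal (Real.exp (-(lam ^ 2 / 16) * (c - v) ^ 2)) ≤
      30 * ENNReal.ofReal lam⁻¹ * ‖c‖ₑ ^ (-(1 / 8) : ℝ) := by
  rcases eq_or_ne c 0 with rfl | hc
  · rw [enorm_zero, ENNReal.zero_rpow_of_neg (by norm_num), ENNReal.mul_top]
    · exact le_top
    · simp [hl]
  have hc' : 0 < |c| := abs_pos.2 hc
  set E : ℝ → ℝ≥0∞ := fun v => ENNReal.ofReal (Real.exp (-(lam ^ 2 / 16) * (c - v) ^ 2)) with hE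
  set F : ℝ≥0∞ := ENNReal.ofReal (Real.exp (-(lam ^ 2 / 64) * c ^ 2)) with hF
  have hpt : ∀ v ∈ Set.Ioi (0 : ℝ), ‖v‖ₑ ^ (-(1 / 8) : ℝ) * E v ≤
      ‖c / 2‖ₑ ^ (-(1 / 8) : ℝ) * E v +
        (Set.Ioc 0 |c / 2|).indicator (fun v => ‖v‖ₑ ^ (-(1 / 8) : ℝ) * F) v := by
    intro v hv
    have hv : 0 < v := hv
    by_cases h : v ≤ |c / 2|
    · rw [Set.indicator_of_mem (show v ∈ Set.Ioc 0 |c / 2| from ⟨hv, h⟩)]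
      refine le_trans ?_ le_add_self
      gcongr
      refine ENNReal.ofReal_le_ofReal (Real.exp_le_exp.2 ?_)
      have h2 : c ^ 2 / 4 ≤ (c - v) ^ 2 := by
        rw [show c ^ 2 / 4 = (c / 2) ^ 2 by ring]
        refine sq_le_sq.2 ?_
        have := abs_sub_abs_le_abs_sub c v
        rw [abs_of_pos hv] at this
        rw [abs_div, abs_two] at h ⊢
        linarith
      nlinarith [sq_nonneg lam]
    · refine le_trans ?_ le_self_add
      gcongr ?_ * _
      rw [ENNReal.rpow_neg, ENNReal.rpow_neg, ENNReal.inv_le_inv]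
      refine ENNReal.rpow_le_rpow ?_ (by norm_num)
      rw [← ofReal_norm, ← ofReal_norm, Real.norm_eq_abs, Real.norm_eq_abs, abs_of_pos hv]
      exact ENNReal.ofReal_le_ofReal (not_le.1 h).le
  have hcn : ‖c‖ₑ ^ (-(1 / 8) : ℝ) = ENNReal.ofReal (|c| ^ (-(1 / 8) : ℝ)) := by
    rw [← ofReal_norm, ENNReal.ofReal_rpow_of_pos (norm_pos_iff.2 hc), Real.norm_eq_abs]
  have hEm : Measurable E := by fun_prop
  have hcn2 : ‖c / 2‖ₑ ^ (-(1 / 8) : ℝ) ≤ ENNReal.ofReal (2 * |c| ^ (-(1 / 8) : ℝ)) := by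
    rw [← ofReal_norm, ENNReal.ofReal_rpow_of_pos (norm_pos_iff.2 (by simpa using hc)), Real.norm_eq_abs]
    refine ENNReal.ofReal_le_ofReal ?_
    rw [abs_div, abs_two, Real.div_rpow hc'.le zero_le_two, div_eq_mul_inv, mul_comm,
      Real.rpow_neg zero_le_two, inv_inv]
    gcongr
    calc (2 : ℝ) ^ (1 / 8 : ℝ) ≤ 2 ^ (1 : ℝ) :=
          Real.rpow_le_rpow_of_exponent_le one_le_two (by norm_num)
      _ = 2 := Real.rpow_one 2
  have hmain : √(Real.pi / (lam ^ 2 / 16)) ≤ 8 * lam⁻¹ := by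
    rw [Real.sqrt_le_left (by positivity)]
    rw [div_le_iff₀ (by positivity)]
    have : (8 * lam⁻¹) ^ 2 * (lam ^ 2 / 16) = 4 := by field_simp; norm_num
    rw [this]; exact Real.pi_le_four
  have hsecond : Real.exp (-(lam ^ 2 / 64) * c ^ 2) * (|c / 2| ^ (1 - 1 / 8 : ℝ) / (1 - 1 / 8))
      ≤ 14 * lam⁻¹ * |c| ^ (-(1 / 8) : ℝ) := by
    have hexp : Real.exp (-(lam ^ 2 / 64) * c ^ 2) ≤ 8 * lam⁻¹ * |c|⁻¹ := by
      have hx : 0 < lam * |c| / 8 := by positivity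
      have h1 : lam * |c| / 8 ≤ Real.exp (lam ^ 2 / 64 * c ^ 2) := by
        have := Real.add_one_le_exp (lam ^ 2 / 64 * c ^ 2)
        have h2 : lam ^ 2 / 64 * c ^ 2 = (lam * |c| / 8) ^ 2 := by
          rw [← sq_abs c]; ring
        nlinarith [sq_nonneg (lam * |c| / 8 - 1)]
      rw [neg_mul, Real.exp_neg]
      calc (Real.exp (lam ^ 2 / 64 * c ^ 2))⁻¹ ≤ (lam * |c| / 8)⁻¹ := inv_anti₀ hx h1
        _ = 8 * lam⁻¹ * |c|⁻¹ := by field_simp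
    have hpow : |c / 2| ^ (1 - 1 / 8 : ℝ) / (1 - 1 / 8) ≤ (8 / 7) * (|c| * |c| ^ (-(1 / 8) : ℝ)) := by
      have : |c / 2| ^ (1 - 1 / 8 : ℝ) ≤ |c| * |c| ^ (-(1 / 8) : ℝ) := by
        calc |c / 2| ^ (1 - 1 / 8 : ℝ) ≤ |c| ^ (1 - 1 / 8 : ℝ) := by
              refine Real.rpow_le_rpow (abs_nonneg _) ?_ (by norm_num)
              rw [abs_div, abs_two]; linarith
          _ = |c| * |c| ^ (-(1 / 8) : ℝ) := by
              rw [show (1 - 1 / 8 : ℝ) = 1 + -(1 / 8) by norm_num, Real.rpow_add hc', Real.rpow_one]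
      rw [div_le_iff₀ (by norm_num)]
      linarith
    calc _ ≤ (8 * lam⁻¹ * |c|⁻¹) * ((8 / 7) * (|c| * |c| ^ (-(1 / 8) : ℝ))) := by gcongr
      _ = (64 / 7) * lam⁻¹ * |c| ^ (-(1 / 8) : ℝ) := by field_simp; ring
      _ ≤ _ := by gcongr; norm_num
  calc ∫⁻ v in Set.Ioi (0 : ℝ), ‖v‖ₑ ^ (-(1 / 8) : ℝ) * E v
      ≤ ∫⁻ v in Set.Ioi (0 : ℝ), (‖c / 2‖ₑ ^ (-(1 / 8) : ℝ) * E v +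
          (Set.Ioc 0 |c / 2|).indicator (fun v => ‖v‖ₑ ^ (-(1 / 8) : ℝ) * F) v) :=
        setLIntegral_mono' measurableSet_Ioi hpt
    _ ≤ ∫⁻ v, (‖c / 2‖ₑ ^ (-(1 / 8) : ℝ) * E v +
          (Set.Ioc 0 |c / 2|).indicator (fun v => ‖v‖ₑ ^ (-(1 / 8) : ℝ) * F) v) :=
        setLIntegral_le_lintegral _ _
    _ = ‖c / 2‖ₑ ^ (-(1 / 8) : ℝ) * ENNReal.ofReal √(Real.pi / (lam ^ 2 / 16)) +
          F * ENNReal.ofReal (|c / 2| ^ (1 - 1 / 8 : ℝ) / (1 - 1 / 8)) := by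
        rw [lintegral_add_left (hEm.const_mul _), lintegral_const_mul _ hEm,
          lintegral_gaussian_sub (by positivity), lintegral_indicator measurableSet_Ioc,
          lintegral_mul_const _ (by fun_prop),
          setLIntegral_enorm_rpow_neg_Ioc (by norm_num) (abs_nonneg _), mul_comm F]
    _ ≤ ENNReal.ofReal (2 * |c| ^ (-(1 / 8) : ℝ)) * ENNReal.ofReal (8 * lam⁻¹) +
          ENNReal.ofReal (14 * lam⁻¹ * |c| ^ (-(1 / 8) : ℝ)) := by
        rw [hF, ← ENNReal.ofReal_mul (Real.exp_pos _).le]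
        gcongr
    _ = 30 * ENNReal.ofReal lam⁻¹ * ‖c‖ₑ ^ (-(1 / 8) : ℝ) := by
        rw [hcn, ← ENNReal.ofReal_mul (by positivity), ← ENNReal.ofReal_add (by positivity)
          (by positivity), show (30 : ℝ≥0∞) = ENNReal.ofReal 30 by norm_num,
          ← ENNReal.ofReal_mul (by norm_num), ← ENNReal.ofReal_mul (by positivity)]
        congr 1; ring

/-- The substitution `v = q²` turns `|q| ^ (3/4) dq` into a multiple of `v ^ (-1/8) dv`. -/
theorem lintegral_rpow_mul_gaussian_sq_le {lam : ℝ} (hl : 0 < lam) (c : ℝ) :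
    ∫⁻ q : ℝ, ‖q‖ₑ ^ (3 / 4 : ℝ) *
        ENNReal.ofReal (Real.exp (-(lam ^ 2 / 16) * (c - q ^ 2) ^ 2)) ≤
      30 * ENNReal.ofReal lam⁻¹ * ‖c‖ₑ ^ (-(1 / 8) : ℝ) := by
  set g : ℝ → ℝ≥0∞ := fun v => ‖v‖ₑ ^ (-(1 / 8) : ℝ) *
        ENNReal.ofReal (Real.exp (-(lam ^ 2 / 16) * (c - v) ^ 2)) with hg
  set h : ℝ → ℝ≥0∞ := fun q => ‖q‖ₑ ^ (3 / 4 : ℝ) *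
        ENNReal.ofReal (Real.exp (-(lam ^ 2 / 16) * (c - q ^ 2) ^ 2)) with hh
  have himg : (fun q : ℝ => q ^ 2) '' Set.Ioi 0 = Set.Ioi 0 := by
    ext v; constructor
    · rintro ⟨q, hq, rfl⟩; exact pow_pos (show 0 < q from hq) 2
    · intro hv; exact ⟨√v, Real.sqrt_pos.2 hv, Real.sq_sqrt (le_of_lt hv)⟩
  have hsub : ∫⁻ v in Set.Ioi (0 : ℝ), g v = 2 * ∫⁻ q in Set.Ioi (0 : ℝ), h q := by
    have := lintegral_image_eq_lintegral_abs_deriv_mul (s := Set.Ioi (0 : ℝ))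
      (f := fun q : ℝ => q ^ 2) (f' := fun q => 2 * q) measurableSet_Ioi
      (fun q _ => by simpa using (hasDerivAt_pow 2 q).hasDerivWithinAt)
      (fun a ha b hb hab => by
        exact (pow_left_inj₀ (le_of_lt ha) (le_of_lt hb) two_ne_zero).1 hab) g
    rw [himg] at this
    rw [this, ← lintegral_const_mul' _ _ (by norm_num)]
    refine setLIntegral_congr_fun measurableSet_Ioi fun q hq => ?_
    have hq : 0 < q := hq
    have hpow : ENNReal.ofReal q * ‖q ^ 2‖ₑ ^ (-(1 / 8) : ℝ) = ‖q‖ₑ ^ (3 / 4 : ℝ) := by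
      rw [Real.enorm_of_nonneg (by positivity), Real.enorm_of_nonneg hq.le,
        ENNReal.ofReal_rpow_of_pos (by positivity), ENNReal.ofReal_rpow_of_pos hq,
        ← ENNReal.ofReal_mul hq.le]
      congr 1
      rw [← Real.rpow_natCast, ← Real.rpow_mul hq.le]
      nth_rewrite 1 [← Real.rpow_one q]
      rw [← Real.rpow_add hq]
      norm_num
    simp only [hg, hh]
    rw [abs_of_pos (by positivity), ENNReal.ofReal_mul zero_le_two, ← hpow]
    simp only [ENNReal.ofReal_ofNat]
    ring
  have hneg : ∫⁻ q in Set.Iic (0 : ℝ), h q = ∫⁻ q in Set.Ioi (0 : ℝ), h q := by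
    rw [setLIntegral_congr Iio_ae_eq_Iic.symm, ← lintegral_indicator measurableSet_Iio,
      ← lintegral_indicator measurableSet_Ioi, ← lintegral_neg_eq_self]
    refine lintegral_congr fun u => ?_
    simp only [Set.indicator, Set.mem_Iio, Set.mem_Ioi, hh, enorm_neg, neg_sq, Left.neg_neg_iff]
  calc ∫⁻ q, h q = (∫⁻ q in Set.Iic (0 : ℝ), h q) + ∫⁻ q in Set.Ioi (0 : ℝ), h q := by
        rw [← Set.compl_Iic, lintegral_add_compl _ measurableSet_Iic]
    _ = ∫⁻ v in Set.Ioi (0 : ℝ), g v := by rw [hneg, hsub, two_mul]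
    _ ≤ _ := lintegral_rpow_neg_mul_gaussian_le hl c

theorem ENNReal.mul_rpow_neg_le_add (x y z : ℝ≥0∞) (hx : x ≠ ⊤) (hy : y ≠ ⊤) (hz : z ≠ ⊤) :
    x ^ (-(1 / 2) : ℝ) * (y * z) ^ (-(1 / 8) : ℝ) ≤
      x ^ (-(3 / 4) : ℝ) + y ^ (-(3 / 4) : ℝ) + z ^ (-(3 / 4) : ℝ) := by
  -- every factor is at most the corresponding power of the smallest base
  set m := min x (min y z) with hm
  have hmt : m ≠ ⊤ := ne_top_of_le_ne_top hx (min_le_left _ _)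
  have anti : ∀ {r : ℝ} {a : ℝ≥0∞}, 0 ≤ r → m ≤ a → a ^ (-r) ≤ m ^ (-r) := by
    intro r a hr h
    rw [ENNReal.rpow_neg, ENNReal.rpow_neg, ENNReal.inv_le_inv]
    exact ENNReal.rpow_le_rpow h hr
  have hmx : m ≤ x := min_le_left _ _
  have hmy : m ≤ y := (min_le_right _ _).trans (min_le_left _ _)
  have hmz : m ≤ z := (min_le_right _ _).trans (min_le_right _ _)
  have h1 : x ^ (-(1 / 2) : ℝ) * (y * z) ^ (-(1 / 8) : ℝ) ≤ m ^ (-(3 / 4) : ℝ) := by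
    rw [ENNReal.mul_rpow_of_ne_top hy hz]
    rcases eq_or_ne m 0 with h0 | h0
    · rw [h0, ENNReal.zero_rpow_of_neg (by norm_num)]; exact le_top
    calc x ^ (-(1 / 2) : ℝ) * (y ^ (-(1 / 8) : ℝ) * z ^ (-(1 / 8) : ℝ))
        ≤ m ^ (-(1 / 2) : ℝ) * (m ^ (-(1 / 8) : ℝ) * m ^ (-(1 / 8) : ℝ)) :=
          mul_le_mul' (anti (by norm_num) hmx)
            (mul_le_mul' (anti (by norm_num) hmy) (anti (by norm_num) hmz))
      _ = m ^ (-(3 / 4) : ℝ) := by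
          rw [← ENNReal.rpow_add _ _ h0 hmt, ← ENNReal.rpow_add _ _ h0 hmt]; norm_num
  refine h1.trans ?_
  rcases min_choice x (min y z) with h | h
  · rw [hm, h, add_assoc]; exact le_self_add
  · rcases min_choice y z with h' | h'
    · rw [hm, h, h', add_right_comm]; exact le_add_self
    · rw [hm, h, h']; exact le_add_self

/-- The Schur integral with weight `|t - s| ^ (3/4)`. For fixed `p = t + s` the integral over
`q = t - s` is at most a multiple of `lam⁻¹ |2 b - p²| ^ (-1/8)`, and
`2 b - p² = (β - p) (β + p)` with `β = √(2 b)`. -/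
theorem lintegral_schur_weight_le {lam : ℝ} (hl : 0 < lam) (a : ℝ) {b : ℝ} (hb : 0 ≤ b) :
    ∫⁻ t in Set.Icc (-1 : ℝ) 1, ∫⁻ s in Set.Icc (-1 : ℝ) 1,
      ‖a - (t + s)‖ₑ ^ (-(1 / 2) : ℝ) *
        ENNReal.ofReal (Real.exp (-(lam ^ 2 / 4) * (b - (t ^ 2 + s ^ 2)) ^ 2)) *
        ‖t - s‖ₑ ^ (3 / 4 : ℝ) ≤ 1080 * ENNReal.ofReal lam⁻¹ := by
  set β := √(2 * b) with hβ
  have hβ2 : β ^ 2 = 2 * b := Real.sq_sqrt (by positivity)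
  set S := Set.Icc (-2 : ℝ) 2
  set F : ℝ → ℝ → ℝ≥0∞ := fun t p => S.indicator (fun p => ‖a - p‖ₑ ^ (-(1 / 2) : ℝ)) p *
    (‖2 * t - p‖ₑ ^ (3 / 4 : ℝ) * ENNReal.ofReal (Real.exp (-(lam ^ 2 / 16) *
      ((2 * b - p ^ 2) - (2 * t - p) ^ 2) ^ 2))) with hF
  have hSm : Measurable (S.indicator (fun p => ‖a - p‖ₑ ^ (-(1 / 2) : ℝ))) :=
    Measurable.indicator (by fun_prop) measurableSet_Icc
  have hFm : Measurable (Function.uncurry F) :=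
    (hSm.comp measurable_snd).mul (by fun_prop)
  have hin : ∀ p : ℝ, ∫⁻ t, F t p ≤ S.indicator (fun p => ‖a - p‖ₑ ^ (-(1 / 2) : ℝ)) p *
      (30 * ENNReal.ofReal lam⁻¹ * ‖2 * b - p ^ 2‖ₑ ^ (-(1 / 8) : ℝ)) := by
    intro p
    simp only [hF]
    rw [lintegral_const_mul _ (by fun_prop)]
    gcongr
    set h : ℝ → ℝ≥0∞ := fun q => ‖q‖ₑ ^ (3 / 4 : ℝ) *
        ENNReal.ofReal (Real.exp (-(lam ^ 2 / 16) * ((2 * b - p ^ 2) - q ^ 2) ^ 2)) with hh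
    have hhm : Measurable h := by fun_prop
    calc ∫⁻ t, h (2 * t - p) = ENNReal.ofReal |(2 : ℝ)⁻¹| * ∫⁻ q, h (q - p) :=
by
          have hm : Measurable fun q => h (q - p) := by fun_prop
          rw [← lintegral_map hm (measurable_const_mul 2), Real.map_volume_mul_left two_ne_zero,
            lintegral_smul_measure, smul_eq_mul]
      _ ≤ 1 * ∫⁻ q, h (q - p) := by
          gcongr
          rw [ENNReal.ofReal_le_one, abs_of_pos] <;> norm_num
      _ = ∫⁻ q, h q := by rw [one_mul, lintegral_sub_right_eq_self]
      _ ≤ _ := lintegral_rpow_mul_gaussian_sq_le hl _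
  calc ∫⁻ t in Set.Icc (-1 : ℝ) 1, ∫⁻ s in Set.Icc (-1 : ℝ) 1,
      ‖a - (t + s)‖ₑ ^ (-(1 / 2) : ℝ) *
        ENNReal.ofReal (Real.exp (-(lam ^ 2 / 4) * (b - (t ^ 2 + s ^ 2)) ^ 2)) *
        ‖t - s‖ₑ ^ (3 / 4 : ℝ)
      ≤ ∫⁻ t in Set.Icc (-1 : ℝ) 1, ∫⁻ s in Set.Icc (-1 : ℝ) 1, F t (t + s) := by
        refine setLIntegral_mono' measurableSet_Icc fun t ht => ?_
        refine setLIntegral_mono' measurableSet_Icc fun s hs => ?_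
        simp only [hF]
        rw [Set.indicator_of_mem (show t + s ∈ S from
          ⟨by linarith [ht.1, hs.1], by linarith [ht.2, hs.2]⟩), mul_assoc,
          mul_comm (ENNReal.ofReal _) (‖t - s‖ₑ ^ (3 / 4 : ℝ)),
          show 2 * t - (t + s) = t - s by ring,
          show -(lam ^ 2 / 4) * (b - (t ^ 2 + s ^ 2)) ^ 2 =
            -(lam ^ 2 / 16) * (2 * b - (t + s) ^ 2 - (t - s) ^ 2) ^ 2 by ring]
    _ ≤ ∫⁻ t, ∫⁻ s, F t (t + s) := by
        refine (setLIntegral_le_lintegral _ _).trans ?_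
        exact lintegral_mono fun t => setLIntegral_le_lintegral _ _
    _ = ∫⁻ t, ∫⁻ p, F t p := lintegral_congr fun t => lintegral_add_left_eq_self _ t
    _ = ∫⁻ p, ∫⁻ t, F t p := lintegral_lintegral_swap hFm.aemeasurable
    _ ≤ ∫⁻ p, S.indicator (fun p => ‖a - p‖ₑ ^ (-(1 / 2) : ℝ)) p *
      (30 * ENNReal.ofReal lam⁻¹ * ‖2 * b - p ^ 2‖ₑ ^ (-(1 / 8) : ℝ)) := lintegral_mono hin
    _ = ∫⁻ p in S, 30 * ENNReal.ofReal lam⁻¹ * (‖a - p‖ₑ ^ (-(1 / 2) : ℝ) *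
          (‖β - p‖ₑ * ‖-β - p‖ₑ) ^ (-(1 / 8) : ℝ)) := by
        rw [← lintegral_indicator measurableSet_Icc]
        refine lintegral_congr fun p => ?_
        by_cases hp : p ∈ S
        · rw [Set.indicator_of_mem hp, Set.indicator_of_mem hp, ← enorm_mul,
            show (β - p) * (-β - p) = -(2 * b - p ^ 2) by rw [← hβ2]; ring, enorm_neg]
          ring
        · rw [Set.indicator_of_notMem hp, Set.indicator_of_notMem hp, zero_mul]
    _ ≤ ∫⁻ p in S, 30 * ENNReal.ofReal lam⁻¹ * (‖a - p‖ₑ ^ (-(3 / 4) : ℝ) +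
          ‖β - p‖ₑ ^ (-(3 / 4) : ℝ) + ‖-β - p‖ₑ ^ (-(3 / 4) : ℝ)) := by
        refine lintegral_mono fun p => ?_
        gcongr
        exact ENNReal.mul_rpow_neg_le_add _ _ _ enorm_ne_top enorm_ne_top enorm_ne_top
    _ = 30 * ENNReal.ofReal lam⁻¹ * ((∫⁻ p in S, ‖a - p‖ₑ ^ (-(3 / 4) : ℝ)) +
          (∫⁻ p in S, ‖β - p‖ₑ ^ (-(3 / 4) : ℝ)) + ∫⁻ p in S, ‖-β - p‖ₑ ^ (-(3 / 4) : ℝ)) := by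
        rw [lintegral_const_mul _ (by fun_prop), lintegral_add_left (by fun_prop),
          lintegral_add_left (by fun_prop)]
    _ ≤ 30 * ENNReal.ofReal lam⁻¹ * (12 + 12 + 12) := by
        have : ∀ x : ℝ, ∫⁻ p in S, ‖x - p‖ₑ ^ (-(3 / 4) : ℝ) ≤ 12 := by
          intro x
          refine (setLIntegral_enorm_sub_rpow_neg_le (by norm_num) (by norm_num) x S).trans ?_
          rw [Real.volume_Icc, ← ENNReal.ofReal_add (by norm_num) (by norm_num)]
          norm_num
        gcongr <;> exact this _
    _ ≤ 1080 * ENNReal.ofReal lam⁻¹ := by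
        rw [mul_right_comm]; norm_num

/-! ### The oscillating factor -/

/-- The oscillating factor `exp (i lam (x² t + y t²))` at `z = (x, y)`. -/
noncomputable def oscPhase (lam : ℝ) (z : ℝ × ℝ) (t : ℝ) : ℂ :=
  Complex.exp (Complex.I * ((lam * (z.1 ^ 2 * t + z.2 * t ^ 2) : ℝ) : ℂ))

theorem norm_oscPhase (lam : ℝ) (z : ℝ × ℝ) (t : ℝ) : ‖oscPhase lam z t‖ = 1 := by
  rw [oscPhase, mul_comm, Complex.norm_exp_ofReal_mul_I]

theorem Continuous.oscPhase {X : Type*} [TopologicalSpace X] {u : X → ℝ × ℝ} {v : X → ℝ}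
    (hu : Continuous u) (lam : ℝ) (hv : Continuous v) :
    Continuous fun x => oscPhase lam (u x) (v x) := by
  unfold _root_.oscPhase
  fun_prop

theorem enorm_cpow_half_le {lam A : ℝ} (hl : 0 < lam) :
    ‖((Real.pi : ℂ) / (1 - Complex.I * ((lam * A : ℝ) : ℂ))) ^ (1 / 2 : ℂ)‖ₑ ≤
      2 * ENNReal.ofReal (lam ^ (-(1 / 2) : ℝ)) * ‖A‖ₑ ^ (-(1 / 2) : ℝ) := by
  rcases eq_or_ne A 0 with rfl | hA
  · rw [enorm_zero, ENNReal.zero_rpow_of_neg (by norm_num), ENNReal.mul_top]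
    · exact le_top
    · exact mul_ne_zero two_ne_zero (ENNReal.ofReal_pos.2 (Real.rpow_pos_of_pos hl _)).ne'
  have hA' : 0 < |A| := abs_pos.2 hA
  have h1 : lam * |A| ≤ ‖1 - Complex.I * ((lam * A : ℝ) : ℂ)‖ := by
    have := Complex.abs_im_le_norm (1 - Complex.I * ((lam * A : ℝ) : ℂ))
    simpa [abs_mul, abs_of_pos hl] using this
  rw [show (1 / 2 : ℂ) = ((1 / 2 : ℝ) : ℂ) by norm_num, ← ofReal_norm, Complex.norm_cpow_real,
    ← ofReal_norm, Real.norm_eq_abs, ENNReal.ofReal_rpow_of_pos hA',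
    show (2 : ℝ≥0∞) = ENNReal.ofReal 2 by norm_num, ← ENNReal.ofReal_mul zero_le_two,
    ← ENNReal.ofReal_mul (by positivity)]
  refine ENNReal.ofReal_le_ofReal ?_
  rw [norm_div, Complex.norm_real, Real.norm_of_nonneg Real.pi_pos.le]
  calc (Real.pi / ‖1 - Complex.I * ((lam * A : ℝ) : ℂ)‖) ^ (1 / 2 : ℝ)
      ≤ (2 ^ 2 * (lam * |A|)⁻¹) ^ (1 / 2 : ℝ) := by
        refine Real.rpow_le_rpow (by positivity) ?_ (by norm_num)
        rw [div_eq_mul_inv]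
        gcongr
        linarith [Real.pi_le_four]
    _ = 2 * lam ^ (-(1 / 2) : ℝ) * |A| ^ (-(1 / 2) : ℝ) := by
        rw [Real.mul_rpow (by positivity) (by positivity), Real.inv_rpow (by positivity),
          Real.mul_rpow hl.le hA'.le, mul_inv, ← Real.rpow_neg hl.le, ← Real.rpow_neg hA'.le,
          ← Real.rpow_natCast, ← Real.rpow_mul zero_le_two]
        norm_num [mul_assoc]

/-- The inner product of two oscillating factors against the weight `exp (-x² - y²)`. The variable `x`
enters through `x²`, which yields `(π / (1 - i lam A)) ^ (1/2)`, while `y` contributes the Fourier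
transform of a Gaussian. -/
theorem enorm_integral_gaussian_phase_le {lam : ℝ} (hl : 0 < lam) (A B : ℝ) :
    ‖∫ z : ℝ × ℝ, ((Real.exp (-(z.1 ^ 2 + z.2 ^ 2)) : ℝ) : ℂ) *
        Complex.exp (Complex.I * ((lam * (z.1 ^ 2 * A + z.2 * B) : ℝ) : ℂ))‖ₑ ≤
      4 * ENNReal.ofReal (lam ^ (-(1 / 2) : ℝ)) * (‖A‖ₑ ^ (-(1 / 2) : ℝ) *
        ENNReal.ofReal (Real.exp (-(lam ^ 2 / 4) * B ^ 2))) := by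
  have h1 : ∀ z : ℝ × ℝ, ((Real.exp (-(z.1 ^ 2 + z.2 ^ 2)) : ℝ) : ℂ) *
        Complex.exp (Complex.I * ((lam * (z.1 ^ 2 * A + z.2 * B) : ℝ) : ℂ)) =
      Complex.exp (-(1 - Complex.I * ((lam * A : ℝ) : ℂ)) * (z.1 : ℂ) ^ 2) *
      (Complex.exp (Complex.I * ((lam * B : ℝ) : ℂ) * (z.2 : ℂ)) *
        Complex.exp (-1 * (z.2 : ℂ) ^ 2)) := by
    intro z
    rw [Complex.ofReal_exp, ← Complex.exp_add, ← Complex.exp_add, ← Complex.exp_add]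
    congr 1
    push_cast; ring
  have hre : 0 < (1 - Complex.I * ((lam * A : ℝ) : ℂ)).re := by simp
  simp_rw [h1]
  rw [Measure.volume_eq_prod, integral_prod_mul
    (fun x : ℝ => Complex.exp (-(1 - Complex.I * ((lam * A : ℝ) : ℂ)) * (x : ℂ) ^ 2))
    (fun y : ℝ => Complex.exp (Complex.I * ((lam * B : ℝ) : ℂ) * (y : ℂ)) *
        Complex.exp (-1 * (y : ℂ) ^ 2)),
    integral_gaussian_complex hre, fourierIntegral_gaussian (by simp), enorm_mul, enorm_mul]
  have h2 : ‖((Real.pi : ℂ) / 1) ^ (1 / 2 : ℂ)‖ₑ ≤ 2 := by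
    rw [show (1 / 2 : ℂ) = ((1 / 2 : ℝ) : ℂ) by norm_num, ← ofReal_norm, Complex.norm_cpow_real,
      div_one, Complex.norm_real, Real.norm_of_nonneg Real.pi_pos.le, ← Real.sqrt_eq_rpow,
      show (2 : ℝ≥0∞) = ENNReal.ofReal 2 by norm_num]
    refine ENNReal.ofReal_le_ofReal (Real.sqrt_le_left zero_le_two |>.2 ?_)
    linarith [Real.pi_le_four]
  have h3 : ‖Complex.exp (-((lam * B : ℝ) : ℂ) ^ 2 / (4 * 1))‖ₑ =
      ENNReal.ofReal (Real.exp (-(lam ^ 2 / 4) * B ^ 2)) := by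
    rw [show -((lam * B : ℝ) : ℂ) ^ 2 / (4 * 1) = ((-(lam ^ 2 / 4) * B ^ 2 : ℝ) : ℂ) by
      push_cast; ring, ← Complex.ofReal_exp, ← ofReal_norm, Complex.norm_real,
      Real.norm_of_nonneg (Real.exp_pos _).le]
  rw [h3]
  calc _ ≤ (2 * ENNReal.ofReal (lam ^ (-(1 / 2) : ℝ)) * ‖A‖ₑ ^ (-(1 / 2) : ℝ)) *
        (2 * ENNReal.ofReal (Real.exp (-(lam ^ 2 / 4) * B ^ 2))) := by
        gcongr
        exact enorm_cpow_half_le hl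
    _ = (2 * 2) * ENNReal.ofReal (lam ^ (-(1 / 2) : ℝ)) * (‖A‖ₑ ^ (-(1 / 2) : ℝ) *
        ENNReal.ofReal (Real.exp (-(lam ^ 2 / 4) * B ^ 2))) := by ring
    _ = _ := by norm_num

theorem oscPhase_mul_conj (lam : ℝ) (z P P' : ℝ × ℝ) :
    oscPhase lam z P.1 * oscPhase lam z P.2 *
        (starRingEnd ℂ) (oscPhase lam z P'.1 * oscPhase lam z P'.2) =
      Complex.exp (Complex.I * ((lam * (z.1 ^ 2 * ((P.1 + P.2) - (P'.1 + P'.2)) +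
        z.2 * ((P.1 ^ 2 + P.2 ^ 2) - (P'.1 ^ 2 + P'.2 ^ 2))) : ℝ) : ℂ)) := by
  simp only [oscPhase, map_mul, ← Complex.exp_conj]
  simp only [Complex.conj_I, Complex.conj_ofReal, ← Complex.exp_add]
  congr 1
  push_cast; ring

/-! ### The `L⁴` bound for the extension operator -/

theorem lintegral_sq_mul_sq_mul_enorm_sub_rpow_le {g : ℝ → ℝ≥0∞}
    (hg : AEMeasurable g (volume.restrict (Set.Icc (-1 : ℝ) 1))) :
    ∫⁻ t in Set.Icc (-1 : ℝ) 1, ∫⁻ s in Set.Icc (-1 : ℝ) 1,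
      g t ^ 2 * g s ^ 2 * ‖t - s‖ₑ ^ (-(3 / 4) : ℝ) ≤
      20 * ∫⁻ t in Set.Icc (-1 : ℝ) 1, g t ^ 4 := by
  have := lintegral_lintegral_mul_le_of_schur (ν := volume.restrict (Set.Icc (-1 : ℝ) 1))
    (k := fun t s : ℝ => ‖t - s‖ₑ ^ (-(3 / 4) : ℝ)) (by unfold Function.uncurry; fun_prop)
    (fun t s => by rw [← enorm_neg, neg_sub]) (W := fun _ => 1) measurable_const
    (hg.pow_const 2) (by simp) (by simp) (M := 10) ?_
  · refine this.trans_eq ?_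
    simp only [inv_one, mul_one, ← pow_mul]
    norm_num
  · refine Filter.Eventually.of_forall fun t => ?_
    simp only [mul_one]
    refine (setLIntegral_enorm_sub_rpow_neg_le (by norm_num) (by norm_num) t _).trans ?_
    rw [Real.volume_Icc, ← ENNReal.ofReal_add (by norm_num) (by norm_num)]
    norm_num

/-- The `L⁴` bound for the extension operator with a Gaussian weight: the fourth power is the square
of an oscillatory integral over pairs `(t, s)`, to which the `T T*` argument and Schur's test apply. -/
theorem lintegral_gaussian_mul_extension_pow_four_le {lam : ℝ} (hl : 0 < lam) {g : ℝ → ℂ}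
    (hg : IntegrableOn g (Set.Icc (-1 : ℝ) 1)) :
    ∫⁻ z : ℝ × ℝ, ENNReal.ofReal (Real.exp (-(z.1 ^ 2 + z.2 ^ 2))) *
        ‖∫ t in Set.Icc (-1 : ℝ) 1, oscPhase lam z t * g t‖ₑ ^ 4 ≤
      172800 * ENNReal.ofReal (lam ^ (-(3 / 2) : ℝ)) *
        ∫⁻ t in Set.Icc (-1 : ℝ) 1, ‖g t‖ₑ ^ 4 := by
  set ν : Measure ℝ := volume.restrict (Set.Icc (-1 : ℝ) 1) with hν
  set k : ℝ × ℝ → ℝ × ℝ → ℝ≥0∞ := fun P P' =>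
    ‖(P.1 + P.2) - (P'.1 + P'.2)‖ₑ ^ (-(1 / 2) : ℝ) * ENNReal.ofReal
      (Real.exp (-(lam ^ 2 / 4) * ((P.1 ^ 2 + P.2 ^ 2) - (P'.1 ^ 2 + P'.2 ^ 2)) ^ 2)) with hk
  set W : ℝ × ℝ → ℝ≥0∞ := fun P => ‖P.1 - P.2‖ₑ ^ (3 / 4 : ℝ) with hW
  have hkm : Measurable (Function.uncurry k) := by
    simp only [hk, Function.uncurry_def]; fun_prop
  have hWm : Measurable W := by fun_prop
  have hG : Integrable (fun P : ℝ × ℝ => g P.1 * g P.2) (ν.prod ν) := hg.mul_prod hg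
  have hw : Integrable (fun z : ℝ × ℝ => Real.exp (-(z.1 ^ 2 + z.2 ^ 2))) := by
    have h1 := integrable_exp_neg_mul_sq (b := 1) one_pos
    refine (h1.mul_prod h1).congr (Filter.Eventually.of_forall fun z => ?_)
    simp only
    rw [← Real.exp_add]; congr 1; ring
  have hκm : Measurable (Function.uncurry fun (z P : ℝ × ℝ) =>
      oscPhase lam z P.1 * oscPhase lam z P.2) := by
    simp only [Function.uncurry_def]
    exact ((continuous_fst.oscPhase lam continuous_snd.fst).mul
      (continuous_fst.oscPhase lam continuous_snd.snd)).measurable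
  have hne : ∀ᵐ P : ℝ × ℝ ∂(ν.prod ν), P.1 ≠ P.2 := by
    rw [Measure.ae_prod_iff_ae_ae]
    · refine Filter.Eventually.of_forall fun t => ?_
      have : ∀ᵐ s : ℝ ∂ν, s ≠ t := Measure.ae_ne ν t
      filter_upwards [this] with s hs using hs.symm
    · exact (measurableSet_eq_fun measurable_fst measurable_snd).compl
  have hschur := lintegral_lintegral_mul_le_of_schur (ν := ν.prod ν) hkm
    (fun P P' => by
      simp only [hk]
      rw [← enorm_neg, neg_sub, ← neg_sub (P'.1 ^ 2 + P'.2 ^ 2), neg_sq])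
    (W := W) (G := fun P => ‖g P.1 * g P.2‖ₑ) hWm hG.aestronglyMeasurable.enorm
    (by
      filter_upwards [hne] with P hP
      exact (ENNReal.rpow_pos (enorm_pos.2 (sub_ne_zero.2 hP)) enorm_ne_top).ne')
    (Filter.Eventually.of_forall fun P => ENNReal.rpow_ne_top_of_nonneg (by norm_num) enorm_ne_top)
    (M := 1080 * ENNReal.ofReal lam⁻¹) (Filter.Eventually.of_forall fun P => by
      rw [lintegral_prod _ (by fun_prop)]
      exact lintegral_schur_weight_le hl _ (by positivity))
  have hTT := lintegral_sq_norm_integral_le hw (fun z => (Real.exp_pos _).le) hκm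
    (fun z P => by rw [norm_mul, norm_oscPhase, norm_oscPhase, one_mul]) hG
  calc ∫⁻ z : ℝ × ℝ, ENNReal.ofReal (Real.exp (-(z.1 ^ 2 + z.2 ^ 2))) *
        ‖∫ t, oscPhase lam z t * g t ∂ν‖ₑ ^ 4
      = ∫⁻ z : ℝ × ℝ, ENNReal.ofReal (Real.exp (-(z.1 ^ 2 + z.2 ^ 2))) *
        ‖∫ P : ℝ × ℝ, (oscPhase lam z P.1 * oscPhase lam z P.2) * (g P.1 * g P.2)
          ∂(ν.prod ν)‖ₑ ^ 2 := by
        refine lintegral_congr fun z => ?_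
        have : ∫ P : ℝ × ℝ, (oscPhase lam z P.1 * oscPhase lam z P.2) * (g P.1 * g P.2)
            ∂(ν.prod ν) = (∫ t, oscPhase lam z t * g t ∂ν) ^ 2 := by
          rw [sq, ← integral_prod_mul]
          refine integral_congr_ae (Filter.Eventually.of_forall fun P => ?_)
          simp only; ring
        rw [this, enorm_pow, ← pow_mul]
    _ ≤ _ := hTT
    _ ≤ ∫⁻ P : ℝ × ℝ, ∫⁻ P' : ℝ × ℝ, 4 * ENNReal.ofReal (lam ^ (-(1 / 2) : ℝ)) *
          (‖g P.1 * g P.2‖ₑ * ‖g P'.1 * g P'.2‖ₑ * k P P') ∂(ν.prod ν) ∂(ν.prod ν) := by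
        refine lintegral_mono fun P => lintegral_mono fun P' => ?_
        simp only [oscPhase_mul_conj]
        calc _ ≤ ‖g P.1 * g P.2‖ₑ * ‖g P'.1 * g P'.2‖ₑ *
              (4 * ENNReal.ofReal (lam ^ (-(1 / 2) : ℝ)) * k P P') := by
              gcongr
              exact enorm_integral_gaussian_phase_le hl _ _
          _ = _ := by ring
    _ = 4 * ENNReal.ofReal (lam ^ (-(1 / 2) : ℝ)) * ∫⁻ P : ℝ × ℝ, ∫⁻ P' : ℝ × ℝ,
          ‖g P.1 * g P.2‖ₑ * ‖g P'.1 * g P'.2‖ₑ * k P P' ∂(ν.prod ν) ∂(ν.prod ν) := by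
        rw [← lintegral_const_mul' _ _ (by finiteness)]
        refine lintegral_congr fun P => ?_
        rw [lintegral_const_mul' _ _ (by finiteness)]
    _ ≤ 4 * ENNReal.ofReal (lam ^ (-(1 / 2) : ℝ)) * (2 * (1080 * ENNReal.ofReal lam⁻¹) *
          ∫⁻ P : ℝ × ℝ, ‖g P.1 * g P.2‖ₑ ^ 2 * (W P)⁻¹ ∂(ν.prod ν)) := by
        gcongr
    _ = 4 * ENNReal.ofReal (lam ^ (-(1 / 2) : ℝ)) * (2 * (1080 * ENNReal.ofReal lam⁻¹) *
          ∫⁻ t, ∫⁻ s, ‖g t‖ₑ ^ 2 * ‖g s‖ₑ ^ 2 * ‖t - s‖ₑ ^ (-(3 / 4) : ℝ) ∂ν ∂ν) := by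
        congr 2
        rw [lintegral_prod]
        · refine lintegral_congr fun t => lintegral_congr fun s => ?_
          simp only [hW]
          rw [enorm_mul, mul_pow, ENNReal.rpow_neg]
        · exact (hG.aestronglyMeasurable.enorm.pow_const 2).mul hWm.inv.aemeasurable
    _ ≤ 4 * ENNReal.ofReal (lam ^ (-(1 / 2) : ℝ)) * (2 * (1080 * ENNReal.ofReal lam⁻¹) *
          (20 * ∫⁻ t, ‖g t‖ₑ ^ 4 ∂ν)) := by
        gcongr
        exact lintegral_sq_mul_sq_mul_enorm_sub_rpow_le hg.aestronglyMeasurable.enorm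
    _ = (4 * 2 * 1080 * 20) * (ENNReal.ofReal (lam ^ (-(1 / 2) : ℝ)) * ENNReal.ofReal lam⁻¹) *
          ∫⁻ t, ‖g t‖ₑ ^ 4 ∂ν := by ring
    _ = _ := by
        rw [← ENNReal.ofReal_mul (by positivity), ← Real.rpow_neg_one lam, ← Real.rpow_add hl]
        norm_num

theorem setLIntegral_extension_pow_four_le {lam : ℝ} (hl : 0 < lam) {g : ℝ → ℂ}
    (hg : IntegrableOn g (Set.Icc (-1 : ℝ) 1)) :
    ∫⁻ z in Set.Icc (-1 : ℝ) 1 ×ˢ Set.Icc (-1 : ℝ) 1,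
        ‖∫ t in Set.Icc (-1 : ℝ) 1, oscPhase lam z t * g t‖ₑ ^ 4 ≤
      1555200 * ENNReal.ofReal (lam ^ (-(3 / 2) : ℝ)) *
        ∫⁻ t in Set.Icc (-1 : ℝ) 1, ‖g t‖ₑ ^ 4 := by
  have hw : ∀ z ∈ Set.Icc (-1 : ℝ) 1 ×ˢ Set.Icc (-1 : ℝ) 1,
      1 ≤ 9 * ENNReal.ofReal (Real.exp (-(z.1 ^ 2 + z.2 ^ 2))) := by
    rintro ⟨x, y⟩ ⟨hx, hy⟩
    have hx2 : x ^ 2 ≤ 1 := (sq_le_one_iff_abs_le_one x).2 (abs_le.2 hx)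
    have hy2 : y ^ 2 ≤ 1 := (sq_le_one_iff_abs_le_one y).2 (abs_le.2 hy)
    rw [show (9 : ℝ≥0∞) = ENNReal.ofReal 9 by norm_num, ← ENNReal.ofReal_mul (by norm_num),
      ENNReal.one_le_ofReal]
    have h1 : Real.exp (x ^ 2 + y ^ 2) ≤ 9 := by
      calc Real.exp (x ^ 2 + y ^ 2) ≤ Real.exp (1 + 1) := by gcongr
        _ = Real.exp 1 * Real.exp 1 := Real.exp_add _ _
        _ ≤ 3 * 3 := by gcongr <;> exact Real.exp_one_lt_three.le
        _ = 9 := by norm_num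
    simp only [Real.exp_neg]
    rw [← div_eq_mul_inv, one_le_div (Real.exp_pos _)]
    exact h1
  calc _ ≤ ∫⁻ z in Set.Icc (-1 : ℝ) 1 ×ˢ Set.Icc (-1 : ℝ) 1,
        9 * (ENNReal.ofReal (Real.exp (-(z.1 ^ 2 + z.2 ^ 2))) *
        ‖∫ t in Set.Icc (-1 : ℝ) 1, oscPhase lam z t * g t‖ₑ ^ 4) := by
        refine setLIntegral_mono' (measurableSet_Icc.prod measurableSet_Icc) fun z hz => ?_
        rw [← mul_assoc]
        exact le_mul_of_one_le_left' (hw z hz)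
    _ ≤ ∫⁻ z : ℝ × ℝ, 9 * (ENNReal.ofReal (Real.exp (-(z.1 ^ 2 + z.2 ^ 2))) *
        ‖∫ t in Set.Icc (-1 : ℝ) 1, oscPhase lam z t * g t‖ₑ ^ 4) := setLIntegral_le_lintegral _ _
    _ ≤ 9 * (172800 * ENNReal.ofReal (lam ^ (-(3 / 2) : ℝ)) *
        ∫⁻ t in Set.Icc (-1 : ℝ) 1, ‖g t‖ₑ ^ 4) := by
        rw [lintegral_const_mul' _ _ (by norm_num)]
        gcongr
        exact lintegral_gaussian_mul_extension_pow_four_le hl hg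
    _ = _ := by
        rw [← mul_assoc, ← mul_assoc]; norm_num

/-! ### Removing the cutoff -/

theorem ENNReal.lintegral_pow_four_le {X : Type*} [MeasurableSpace X] (μ : Measure X) {g : X → ℝ≥0∞}
    (hg : AEMeasurable g μ) :
    (∫⁻ x, g x ∂μ) ^ 4 ≤ μ Set.univ ^ 3 * ∫⁻ x, g x ^ 4 ∂μ := by
  have hpq : (4 : ℝ).HolderConjugate (4 / 3) := by
    rw [Real.holderConjugate_iff]; norm_num
  have h := ENNReal.lintegral_mul_le_Lp_mul_Lq μ hpq hg (aemeasurable_const (b := 1))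
  simp only [Pi.mul_apply, mul_one, ENNReal.one_rpow, lintegral_const, one_mul] at h
  calc (∫⁻ x, g x ∂μ) ^ 4
      ≤ ((∫⁻ x, g x ^ (4 : ℝ) ∂μ) ^ (1 / 4 : ℝ) * μ Set.univ ^ (1 / (4 / 3) : ℝ)) ^ 4 := by gcongr
    _ = (∫⁻ x, g x ^ (4 : ℝ) ∂μ) * μ Set.univ ^ 3 := by
        rw [mul_pow, ← ENNReal.rpow_natCast, ← ENNReal.rpow_natCast, ← ENNReal.rpow_mul,
          ← ENNReal.rpow_mul, ← ENNReal.rpow_natCast (μ Set.univ) 3]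
        norm_num
    _ = _ := by
        rw [mul_comm]
        congr 1
        exact lintegral_congr fun x => by rw [← ENNReal.rpow_natCast]; norm_num

theorem eq_zero_of_mem_cutoffClass {psi : ℝ × ℝ × ℝ → ℂ} (h : psi ∈ cutoffClass) {p : ℝ × ℝ × ℝ}
    (hp : p ∉ Set.Icc (-1 : ℝ) 1 ×ˢ (Set.Icc (-1 : ℝ) 1 ×ˢ Set.Icc (-1 : ℝ) 1)) : psi p = 0 := by
  by_contra hne
  exact hp (h.2.1 (subset_tsupport _ hne))

/-- Integrating `∂_t psi` from `t` to `2` writes `T f` as a superposition of cutoff-free operators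
applied to the truncations `f 1_{t < τ}`. -/
theorem enorm_oscOp_le {lam : ℝ} {psi : ℝ × ℝ × ℝ → ℂ} (h : psi ∈ cutoffClass) {f : ℝ → ℂ}
    (hf : IntegrableOn f (Set.Icc (-1 : ℝ) 1)) (z : ℝ × ℝ) :
    ‖oscOp lam psi f z‖ₑ ≤ ∫⁻ τ in Set.Ioc (-1 : ℝ) 2,
      ‖∫ t in Set.Icc (-1 : ℝ) 1, oscPhase lam z t * (Set.Iio τ).indicator f t‖ₑ := by
  set φ : ℝ → ℂ := fun t => psi (z.1, z.2, t) with hφ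
  have hC : ContDiff ℝ 3 φ := h.2.2.1 z.1 z.2
  have hdc : Continuous (deriv φ) := hC.continuous_deriv (by norm_num)
  have hd1 : ∀ τ, ‖deriv φ τ‖ ≤ 1 := by
    intro τ
    have := h.2.2.2 1 (by simp) z.1 z.2 τ
    rwa [iteratedDeriv_one] at this
  have hφ2 : φ 2 = 0 := eq_zero_of_mem_cutoffClass h (by
    rintro ⟨_, _, h3⟩
    norm_num at h3)
  -- the fundamental theorem of calculus, integrating from `t` to a point outside the support
  have hftc : ∀ t ∈ Set.Icc (-1 : ℝ) 1,
      φ t = - ∫ τ in Set.Ioc (-1 : ℝ) 2, (Set.Ioi t).indicator (deriv φ) τ := by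
    intro t ht
    have h1 : ∫ τ in t..2, deriv φ τ = φ 2 - φ t :=
      intervalIntegral.integral_deriv_eq_sub
        (fun x _ => (hC.differentiable (by norm_num)) x) (hdc.intervalIntegrable _ _)
    rw [setIntegral_indicator measurableSet_Ioi,
      show Set.Ioc (-1 : ℝ) 2 ∩ Set.Ioi t = Set.Ioc t 2 by
        ext τ; simp only [Set.mem_inter_iff, Set.mem_Ioc, Set.mem_Ioi]
        constructor
        · rintro ⟨⟨_, h2⟩, h3⟩; exact ⟨h3, h2⟩
        · rintro ⟨h2, h3⟩; exact ⟨⟨lt_of_le_of_lt ht.1 h2, h3⟩, h2⟩,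
      ← intervalIntegral.integral_of_le (by linarith [ht.2]), h1, hφ2]
    ring
  set ν : Measure ℝ := volume.restrict (Set.Icc (-1 : ℝ) 1) with hν
  set ρ : Measure ℝ := volume.restrict (Set.Ioc (-1 : ℝ) 2) with hρ
  set D : ℝ × ℝ → ℂ := fun q =>
    oscPhase lam z q.1 * f q.1 * (Set.Ioi q.1).indicator (deriv φ) q.2 with hD
  have hDint : Integrable D (ν.prod ρ) := by
    have h1 : Integrable (fun q : ℝ × ℝ => f q.1 * (1 : ℂ)) (ν.prod ρ) :=
      Integrable.mul_prod hf (integrable_const 1)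
    have hm : Measurable fun q : ℝ × ℝ =>
        oscPhase lam z q.1 * {q : ℝ × ℝ | q.1 < q.2}.indicator (fun q => deriv φ q.2) q := by
      have hph : Measurable fun q : ℝ × ℝ => oscPhase lam z q.1 :=
        (continuous_const.oscPhase lam continuous_fst).measurable
      exact hph.mul ((hdc.measurable.comp measurable_snd).indicator
        (measurableSet_lt measurable_fst measurable_snd))
    refine (h1.bdd_mul (c := 1) hm.aestronglyMeasurable ?_).congr ?_
    · refine Filter.Eventually.of_forall fun q => ?_
      rw [norm_mul, norm_oscPhase, one_mul]
      exact (norm_indicator_le_norm_self _ _).trans (hd1 _)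
    · refine Filter.Eventually.of_forall fun q => ?_
      simp only [hD, Set.indicator, Set.mem_ofPred_eq, Set.mem_Ioi]
      ring
  have hop : oscOp lam psi f z = - ∫ t, ∫ τ, D (t, τ) ∂ρ ∂ν := by
    rw [← integral_neg, oscOp, ← setIntegral_eq_integral_of_forall_compl_eq_zero
      (s := Set.Icc (-1 : ℝ) 1)]
    · refine setIntegral_congr_fun measurableSet_Icc fun t ht => ?_
      simp only [hD]
      rw [integral_const_mul, ← mul_neg, ← hftc t ht, oscPhase]
      ring
    · intro t ht
      rw [eq_zero_of_mem_cutoffClass h (p := (z.1, z.2, t)) (fun hp => ht hp.2.2), mul_zero, zero_mul]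
  rw [hop, integral_integral_swap hDint, enorm_neg]
  refine (enorm_integral_le_lintegral_enorm _).trans (lintegral_mono fun τ => ?_)
  have hτ : ∫ t, D (t, τ) ∂ν =
      deriv φ τ * ∫ t, oscPhase lam z t * (Set.Iio τ).indicator f t ∂ν := by
    rw [← integral_const_mul]
    refine integral_congr_ae (Filter.Eventually.of_forall fun t => ?_)
    simp only [hD, Set.indicator, Set.mem_Ioi, Set.mem_Iio]
    split_ifs <;> ring
  simp only [hτ, enorm_mul]
  refine mul_le_of_le_one_left' ?_
  rw [← ofReal_norm, ENNReal.ofReal_le_one]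
  exact hd1 τ

theorem oscOp_eq_zero {lam : ℝ} {psi : ℝ × ℝ × ℝ → ℂ} (h : psi ∈ cutoffClass) (f : ℝ → ℂ)
    {z : ℝ × ℝ} (hz : z ∉ Set.Icc (-1 : ℝ) 1 ×ˢ Set.Icc (-1 : ℝ) 1) : oscOp lam psi f z = 0 := by
  have : ∀ t, psi (z.1, z.2, t) = 0 := fun t => eq_zero_of_mem_cutoffClass h fun hp => hz ⟨hp.1, hp.2.1⟩
  simp [oscOp, this]

/-- The `L⁴` bound for `T`. The constant is `27 * 3 * 1555200`: Hölder's inequality and integration over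
`τ ∈ (-1, 2]` contribute `3 ^ 3` and `3`. -/
theorem lintegral_enorm_oscOp_pow_four_le {lam : ℝ} (hl : 0 < lam) {psi : ℝ × ℝ × ℝ → ℂ}
    (h : psi ∈ cutoffClass) {f : ℝ → ℂ} (hf : IntegrableOn f (Set.Icc (-1 : ℝ) 1)) :
    ∫⁻ z, ‖oscOp lam psi f z‖ₑ ^ 4 ≤
      125971200 * ENNReal.ofReal (lam ^ (-(3 / 2) : ℝ)) * ∫⁻ t, ‖f t‖ₑ ^ 4 := by
  set S : Set (ℝ × ℝ) := Set.Icc (-1 : ℝ) 1 ×ˢ Set.Icc (-1 : ℝ) 1 with hS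
  set ρ : Measure ℝ := volume.restrict (Set.Ioc (-1 : ℝ) 2) with hρ
  set E : ℝ × ℝ → ℝ → ℂ := fun z τ =>
    ∫ t in Set.Icc (-1 : ℝ) 1, oscPhase lam z t * (Set.Iio τ).indicator f t with hE
  have hρ1 : ρ Set.univ = 3 := by
    rw [hρ, Measure.restrict_apply_univ, Real.volume_Ioc]; norm_num
  have hEm : AEStronglyMeasurable (Function.uncurry E) ((volume.restrict S).prod ρ) := by
    have hm : Measurable fun q : ((ℝ × ℝ) × ℝ) × ℝ => oscPhase lam q.1.1 q.2 *
        {q : ((ℝ × ℝ) × ℝ) × ℝ | q.2 < q.1.2}.indicator (fun _ => (1 : ℂ)) q :=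
      (continuous_fst.fst.oscPhase lam continuous_snd).measurable.mul
        (measurable_const.indicator (measurableSet_lt measurable_snd measurable_fst.snd))
    have hD : AEStronglyMeasurable (fun q : ((ℝ × ℝ) × ℝ) × ℝ =>
        oscPhase lam q.1.1 q.2 * (Set.Iio q.1.2).indicator f q.2)
        (((volume.restrict S).prod ρ).prod (volume.restrict (Set.Icc (-1 : ℝ) 1))) := by
      refine (hm.aestronglyMeasurable.mul hf.aestronglyMeasurable.comp_snd).congr
        (Filter.Eventually.of_forall fun q => ?_)
      simp only [Pi.mul_apply, Set.indicator, Set.mem_ofPred_eq, Set.mem_Iio]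
      split_ifs <;> ring
    exact hD.integral_prod_right'
  calc ∫⁻ z, ‖oscOp lam psi f z‖ₑ ^ 4
      = ∫⁻ z in S, ‖oscOp lam psi f z‖ₑ ^ 4 := by
        refine (setLIntegral_eq_of_support_subset fun z hz => ?_).symm
        by_contra hzS
        exact hz (by simp only [oscOp_eq_zero h f hzS, enorm_zero]; norm_num)
    _ ≤ ∫⁻ z in S, 27 * ∫⁻ τ, ‖E z τ‖ₑ ^ 4 ∂ρ := by
        refine lintegral_mono_ae ?_
        filter_upwards [hEm.prodMk_left] with z hz
        calc ‖oscOp lam psi f z‖ₑ ^ 4 ≤ (∫⁻ τ, ‖E z τ‖ₑ ∂ρ) ^ 4 := by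
              gcongr; exact enorm_oscOp_le h hf z
          _ ≤ ρ Set.univ ^ 3 * ∫⁻ τ, ‖E z τ‖ₑ ^ 4 ∂ρ :=
              ENNReal.lintegral_pow_four_le ρ hz.enorm
          _ = _ := by rw [hρ1]; norm_num
    _ = 27 * ∫⁻ τ, (∫⁻ z in S, ‖E z τ‖ₑ ^ 4) ∂ρ := by
        rw [lintegral_const_mul' _ _ (by norm_num),
          lintegral_lintegral_swap (f := fun z τ => ‖E z τ‖ₑ ^ 4) (hEm.enorm.pow_const 4)]
    _ ≤ 27 * ∫⁻ _, (1555200 * ENNReal.ofReal (lam ^ (-(3 / 2) : ℝ)) * ∫⁻ t, ‖f t‖ₑ ^ 4) ∂ρ := by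
        gcongr with τ
        refine (setLIntegral_extension_pow_four_le hl (hf.indicator measurableSet_Iio)).trans ?_
        refine mul_le_mul' le_rfl ((setLIntegral_le_lintegral _ _).trans (lintegral_mono fun t => ?_))
        gcongr
        exact enorm_indicator_le_enorm_self _ _
    _ = (27 * 1555200 * 3) * ENNReal.ofReal (lam ^ (-(3 / 2) : ℝ)) * ∫⁻ t, ‖f t‖ₑ ^ 4 := by
        rw [lintegral_const, hρ1]; ring
    _ = _ := by norm_num

/-! ### The bound for `oscQ` -/

theorem eLpNorm_four_pow_four {X : Type*} [MeasurableSpace X] (μ : Measure X) (f : X → ℂ) :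
    eLpNorm f 4 μ ^ 4 = ∫⁻ x, ‖f x‖ₑ ^ 4 ∂μ := by
  have h := eLpNorm_nnreal_pow_eq_lintegral (μ := μ) (f := f) (p := 4) (by norm_num)
  have e : ∀ a : ℝ≥0∞, a ^ (((4 : ℝ≥0) : ℝ)) = a ^ 4 := fun a => by
    rw [← ENNReal.rpow_natCast]; norm_num
  simpa only [e, ENNReal.coe_ofNat] using h

theorem oscQ_four_le {lam : ℝ} (hl : 0 < lam) :
    oscQ 4 lam ≤ 106 * ENNReal.ofReal (lam ^ (-(3 / 8) : ℝ)) := by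
  refine iSup₂_le fun psi hpsi => iSup₂_le fun f hf => ?_
  have hfi : IntegrableOn f (Set.Icc (-1 : ℝ) 1) :=
    (hf.1.mono_measure Measure.restrict_le_self).integrable (by norm_num)
  refine (ENNReal.pow_le_pow_left_iff (n := 4) (by norm_num)).1 ?_
  calc eLpNorm (oscOp lam psi f) 4 volume ^ 4 = ∫⁻ z, ‖oscOp lam psi f z‖ₑ ^ 4 :=
        eLpNorm_four_pow_four _ _
    _ ≤ 125971200 * ENNReal.ofReal (lam ^ (-(3 / 2) : ℝ)) * ∫⁻ t, ‖f t‖ₑ ^ 4 :=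
        lintegral_enorm_oscOp_pow_four_le hl hpsi hfi
    _ ≤ 106 ^ 4 * ENNReal.ofReal (lam ^ (-(3 / 2) : ℝ)) * 1 := by
        gcongr
        · norm_num
        · rw [← eLpNorm_four_pow_four]
          exact pow_le_one' hf.2 4
    _ = (106 * ENNReal.ofReal (lam ^ (-(3 / 8) : ℝ))) ^ 4 := by
        rw [mul_one, mul_pow, ← ENNReal.ofReal_pow (by positivity), ← Real.rpow_natCast,
          ← Real.rpow_mul hl.le]
        norm_num

theorem mainTheorem2 :
    ∃ C : ℝ≥0, ∀ K : ℝ, 10 ^ 4 < K → ∀ lam : ℝ, 0 < lam →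
      oscQ 4 lam ≤ (C : ℝ≥0∞) *
        (ENNReal.ofReal (K * lam ^ (-(3 / 8) : ℝ)) +
          ENNReal.ofReal (K ^ (-(1 / 2) : ℝ)) * oscQ 4 (lam / K)) := by
  refine ⟨106, fun K hK lam hl => (oscQ_four_le hl).trans ?_⟩
  rw [ENNReal.coe_ofNat]
  gcongr
  refine le_trans (ENNReal.ofReal_le_ofReal ?_) le_self_add
  exact le_mul_of_one_le_left (by positivity) (by linarith)
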